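/- \textbf{Setting.} Let $X=\mathbb{C}\langle a,b,c\rangle$ be the vector space with basis the three colours $a,b,c$, identified with its dual $X^*$ by $a^*\mapsto a$, $b^*\mapsto b$, $c^*\mapsto c$. Let $\mu\colon X\otimes X\otimes X\to\mathbb{C}$ be the linear map that takes a tensor product of three basis vectors to $1$ if they are pairwise different and to $0$ otherwise. \textbf{Bordisms.} The category $\mathrm{Bord}_2^{\mathrm{def,cw}}(\mathcal{D}^{\mathbf 3}_+)$ has as objects finite disjoint unions of oriented circles with finitely many marked points (defects) and a cell decomposition such that each defect lies inside a $1$-cell and each $1$-cell contains at most one defect. A morphism $U\to V$ is a compact oriented surface $\Sigma$ with boundary $(-U)\sqcup V$, with an undirected trivalent graph $\Gamma$ on it (whose edges may end at the defects on the boundary) and a PLCW decomposition each of whose $2$-cells is a \emph{basic-gon}: an oriented $n$-gon $P$, $n\ge 1$, with one of the following graphs $\Gamma_P$ in it: (I) the empty graph; (II) a single line that joins interior points of two different sides and has no vertex; (III) $n=3$, and a single vertex in the interior of $P$ is joined by three lines to an interior point of each of the three sides. \textbf{State spaces.} To a $1$-cell $e$ of an object $U$ put $R_e=X$ if $e$ contains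 a defect and $R_e=\mathbb{C}$ otherwise. Then $\chi^{cw}(U)=\bigotimes_e R_e$; in particular $\chi^{cw}(\emptyset)=\mathbb{C}$. Its standard basis $\mathcal{B}(\chi^{cw}(U))$ consists of the tensor products of the basis vectors $a,b,c$ of the factors $X$ and $1$ of the factors $\mathbb{C}$; thus it is indexed by the assignments of a colour to every $1$-cell of $U$ that contains a defect. \textbf{Morphisms.} For $\Sigma\colon U\to V$ orient the $1$-strata of $\Gamma$ arbitrarily. For a side $e$ of a $2$-cell $P$ let $Q_{(P,e)}$ be $\mathbb{C}$ if $e$ is not crossed by $\Gamma$, $X$ if the stratum crossing $e$ is directed into $P$, and $X^*$ if it is directed out of $P$. The \emph{propagator} is the tensor product, over the $1$-cells of $\Sigma$ not on the in-boundary, of the copairings $1\mapsto\sum_i v_i\otimes v_i^*$, where the two factors belong to the two sides of an interior $1$-cell, or to the one side of a $1$-cell on the out-boundary and to the state space of $V$. The \emph{evaluation} is the tensor product over the $2$-cells $P$ of the following linear forms on $\bigotimes_{e\subset\partial P}Q_{(P,e)}$: the product of the scalars for type (I); the canonical pairing of $X^*$ and $X$ at the two crossed sides times the product of the scalars at the other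 sides for type (II); the map $\mu$, after the identification $X^*\cong X$, for type (III). Then $\chi^{cw}(\Sigma)\colon\chi^{cw}(U)\to\chi^{cw}(V)$ is the propagator followed by the evaluation, with $X^*$ identified with $X$ in the state spaces. \textbf{Colourings.} A $3$-edge-colouring of $(\Sigma,\Gamma)$ is a labelling of the $1$-strata of $\Gamma$ by $a,b,c$ that makes $(\Sigma,\Gamma)$ a surface with defects for the presentation $\langle a,b,c\mid a^2=b^2=c^2=abc=1\rangle$ of the Klein four-group: the labels read around each vertex form, up to cyclic permutation and reversal, one of the relators, so that the three labels at a trivalent vertex are $a,b,c$ in some order. It induces a colour on each boundary $1$-cell crossed by $\Gamma$. \textbf{Proposition.} Let $P$ be a basic-gon of $\mathrm{Bord}_2^{\mathrm{def,cw}}(\mathcal{D}^{\mathbf 3}_+)$, viewed as a cup $\mathbb{D}_P\colon\emptyset\to\partial\mathbb{D}_P$. Then, for every choice of orientations of the $1$-strata, $\chi^{cw}$ assigns to $\mathbb{D}_P$ the vector $v=\chi^{cw}(\mathbb{D}_P)(1)\in\chi^{cw}(\partial\mathbb{D}_P)$ whose coefficient at each basis vector $w\in\mathcal{B}(\chi^{cw}(\partial\mathbb{D}_P))$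 is the number of $3$-edge-colourings of $(P,\Gamma_P)$ that induce the colouring $w$ on $\partial\mathbb{D}_P$. -/

import Mathlib

open scoped TensorProduct

noncomputable section

namespace TaitTFT

/-! ### Undirected defect conditions

There is a single label for the `2`-dimensional strata.  The `1`-strata are undirected, i.e. `x` and
`x⁻¹` are identified, so the `1`-strata meeting at a `0`-stratum give a cyclic word in the labels,
read anticlockwise; reversing the orientation of the disk reverses the word. -/

/-- Undirected defect conditions: the set `Label` of labels of `1`-strata and the cyclic words that
may occur around a `0`-stratum (a `0`-stratum is labelled by the word around it). -/
structure DefectConditions where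
  Label : Type
  words : Set (Cycle Label)
  reverse_mem : ∀ w ∈ words, w.reverse ∈ words

/-- The defect conditions of a presentation `⟨B | R⟩` in which every generator is an involution: the
words around `0`-strata are the relators and their inverses, up to cyclic permutation. -/
def DefectConditions.ofPresentation (B : Type) (R : Set (List B)) : DefectConditions where
  Label := B
  words := {w | ∃ r ∈ R, w = (r : Cycle B) ∨ w = (r.reverse : Cycle B)}
  reverse_mem := by
    rintro w ⟨r, hr, rfl | rfl⟩
    · exact ⟨r, hr, Or.inr (Cycle.reverse_coe r)⟩
    · exact ⟨r, hr, Or.inl (by rw [Cycle.reverse_coe, List.reverse_reverse])⟩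

/-- The three colours, the generators of the Klein four-group. -/
inductive Colour : Type
  | a | b | c
  deriving DecidableEq

instance : Fintype Colour := ⟨{.a, .b, .c}, fun x => by cases x <;> decide⟩

/-- The defect conditions of the presentation `⟨a, b, c | a² = b² = c² = abc = 1⟩` of the Klein
four-group. -/
def kleinFour : DefectConditions :=
  DefectConditions.ofPresentation Colour
    {[Colour.a, Colour.a], [Colour.b, Colour.b], [Colour.c, Colour.c],
      [Colour.a, Colour.b, Colour.c]}

/-- One label for `1`-strata, and a `0`-stratum with `n` incident `1`-strata for every `n ≥ 2`. -/
def anyValent : DefectConditions where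
  Label := Unit
  words := {w | 2 ≤ w.length}
  reverse_mem := fun w hw => by simpa using hw

/-- One label for `1`-strata, and every `0`-stratum has exactly three incident `1`-strata: these are
the defect conditions of undirected trivalent graphs. -/
def trivalent : DefectConditions where
  Label := Unit
  words := {w | w.length = 3}
  reverse_mem := fun w hw => by simpa using hw

/-! ### Surfaces with a PLCW decomposition -/

/-- A compact oriented surface with a PLCW decomposition, up to cellular isomorphism: finitely many
polygons (the `2`-cells), the sides of each numbered anticlockwise, and an orientation reversing
gluing of some of the sides in pairs.  The sides fixed by `glue` are the boundary `1`-cells. -/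
structure PLCWSurface where
  Cell : Type
  [fintypeCell : Fintype Cell]
  [decEqCell : DecidableEq Cell]
  size : Cell → ℕ
  size_pos : ∀ P, 0 < size P
  glue : (Σ P, Fin (size P)) → (Σ P, Fin (size P))
  glue_glue : Function.Involutive glue

attribute [instance] PLCWSurface.fintypeCell PLCWSurface.decEqCell

namespace PLCWSurface

variable (S : PLCWSurface)

/-- The pairs `(P, e)` of a `2`-cell and a side of it; `e` is oriented as part of `∂P`. -/
abbrev Side : Type := Σ P, Fin (S.size P)

/-- Two sides are the same `1`-cell of the surface if they are equal or glued to each other. -/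
def sideSetoid : Setoid S.Side where
  r s t := s = t ∨ s = S.glue t
  iseqv :=
    { refl := fun _ => Or.inl rfl
      symm := by
        rintro s t (rfl | rfl)
        · exact Or.inl rfl
        · exact Or.inr (S.glue_glue t).symm
      trans := by
        rintro s t u (rfl | rfl) (rfl | rfl)
        · exact Or.inl rfl
        · exact Or.inr rfl
        · exact Or.inr rfl
        · exact Or.inl (S.glue_glue u) }

/-- The set of `1`-cells. -/
def OneCell : Type := Quotient S.sideSetoid

/-- The `1`-cell underlying a side. -/
def edge (s : S.Side) : S.OneCell := Quotient.mk S.sideSetoid s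

theorem edge_eq_edge {s t : S.Side} : S.edge s = S.edge t ↔ s = t ∨ s = S.glue t :=
  ⟨fun h => Quotient.exact h, fun h => Quotient.sound h⟩

instance : Finite S.OneCell := inferInstanceAs (Finite (Quotient S.sideSetoid))

/-- The anticlockwise next side of the same polygon. -/
def next (s : S.Side) : S.Side := ⟨s.1, finRotate _ s.2⟩

/-- `S.Follows s t`: the side `t` starts at the final vertex of `s`, and is reached by turning
around that vertex from `s`, crossing interior `1`-cells only. -/
inductive Follows (s : S.Side) : S.Side → Prop
  | base : Follows s (S.next s)
  | step (t : S.Side) : Follows s t → S.glue t ≠ t → Follows s (S.next (S.glue t))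

/-- The surface consisting of a single `n`-gon with no sides glued: a disk. -/
def polygon (n : ℕ) (hn : 0 < n) : PLCWSurface where
  Cell := Unit
  size := fun _ => n
  size_pos := fun _ => hn
  glue := id
  glue_glue := fun _ => rfl

end PLCWSurface

/-! ### Defects on a surface -/

/-- The three stratifications that a `2`-cell with `n` sides may have: no strata of dimension `0`
or `1` (type I); one `1`-stratum joining two different sides and no `0`-stratum (type II); one
`0`-stratum joined to each of the sides by a `1`-stratum (type III). -/
inductive CellPattern (n : ℕ) : Type
  | empty : CellPattern n
  | line (i j : Fin n) (h : i < j) : CellPattern n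
  | star : CellPattern n

/-- `ℓ k` is the label of the `1`-stratum that crosses the side `k`, or `none` if the side is not
crossed.  The labels have to fit the stratification and the defect conditions. -/
def CellPattern.Valid (D : DefectConditions) {n : ℕ} (ℓ : Fin n → Option D.Label) :
    CellPattern n → Prop
  | .empty => ∀ k, ℓ k = none
  | .line i j _ => ∃ x, ℓ i = some x ∧ ℓ j = some x ∧ ∀ k, k ≠ i → k ≠ j → ℓ k = none
  | .star => ∃ f : Fin n → D.Label, (∀ k, ℓ k = some (f k)) ∧
      ((List.ofFn f : List D.Label) : Cycle D.Label) ∈ D.words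

/-- The structure of a surface with defects, with defect conditions `D`, on a surface with a PLCW
decomposition: `0`-strata lie inside `2`-cells, `1`-strata cross `1`-cells away from the `0`-cells,
each `1`-cell at most once, and each `2`-cell looks like one of the three basic patterns. -/
@[ext]
structure DefectSurface (S : PLCWSurface) (D : DefectConditions) where
  label : S.OneCell → Option D.Label
  pattern : ∀ P, CellPattern (S.size P)
  valid : ∀ P, (pattern P).Valid D (fun i => label (S.edge ⟨P, i⟩))

namespace DefectSurface

variable {S : PLCWSurface}

/-- Change of labels of the `1`-strata, on the same stratified surface. -/
def map {D E : DefectConditions} (f : D.Label → E.Label)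
    (hf : ∀ w ∈ D.words, w.map f ∈ E.words) (Γ : DefectSurface S D) : DefectSurface S E where
  label e := (Γ.label e).map f
  pattern := Γ.pattern
  valid P := by
    have h := Γ.valid P
    revert h
    cases Γ.pattern P with
    | empty => intro h k; simp only [h k, Option.map_none]
    | line i j hij =>
      rintro ⟨x, hi, hj, hk⟩
      exact ⟨f x, by simp only [hi, Option.map_some], by simp only [hj, Option.map_some],
        fun k h1 h2 => by simp only [hk k h1 h2, Option.map_none]⟩
    | star =>
      rintro ⟨g, hg, hw⟩
      refine ⟨fun k => f (g k), fun k => by simp only [hg k, Option.map_some], ?_⟩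
      have := hf _ hw
      rwa [Cycle.map_coe, List.map_ofFn] at this

/-- The bleaching map, which forgets the colours of the `1`-strata. -/
def bleach (Γ : DefectSurface S kleinFour) : DefectSurface S anyValent :=
  Γ.map (fun _ => ()) (by
    rintro w ⟨r, hr, rfl | rfl⟩ <;> rcases hr with rfl | rfl | rfl | rfl <;>
      first | exact Nat.le_refl 2 | exact Nat.le_succ 2)

/-- A trivalent graph, regarded as a graph with arbitrary valencies. -/
def toAnyValent (Γ : DefectSurface S trivalent) : DefectSurface S anyValent :=
  Γ.map (D := trivalent) (E := anyValent) (fun x => x) (by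
    intro w hw
    induction w using Quotient.inductionOn with
    | _ l =>
      have h : l.length = 3 := hw
      have h' : (l.map fun x : Unit => x).length = 3 := (List.length_map _).trans h
      exact (Nat.le_succ 2).trans h'.ge)

/-- The `3`-edge-colourings of the trivalent graph `Γ`: the surfaces with defects for the Klein
four-group whose bleaching is `Γ`. -/
def Colouring (Γ : DefectSurface S trivalent) : Type :=
  {C : DefectSurface S kleinFour // C.bleach = Γ.toAnyValent}

theorem size_of_star (Γ : DefectSurface S trivalent) (P : S.Cell) (h : Γ.pattern P = .star) :
    S.size P = 3 := by
  have hv := Γ.valid P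
  rw [h] at hv
  obtain ⟨f, -, hw⟩ := hv
  have hl : (List.ofFn f).length = 3 := hw
  simpa using hl

/-- An orientation of the `1`-strata of `Γ`: for a side `s = (P, e)` crossed by a `1`-stratum,
`out s` says whether that stratum is oriented out of `P` there.  (The value of `out` at sides
that are not crossed is irrelevant.) -/
structure Orientation {D : DefectConditions} (Γ : DefectSurface S D) where
  out : S.Side → Bool
  out_glue : ∀ s, S.glue s ≠ s → Γ.label (S.edge s) ≠ none → out (S.glue s) = !out s
  out_line : ∀ P i j h, Γ.pattern P = .line i j h → out ⟨P, j⟩ = !out ⟨P, i⟩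

end DefectSurface

/-! ### Objects and morphisms -/

/-- A finite disjoint union of circles with defects, with a cell decomposition: the `1`-cells of
each circle are numbered following its orientation, starting from the distinguished point; a `1`-cell
contains at most one defect, whose label is recorded. -/
structure DefectCircles (D : DefectConditions) where
  circles : ℕ
  size : Fin circles → ℕ
  size_pos : ∀ i, 0 < size i
  label : (Σ i, Fin (size i)) → Option D.Label

namespace DefectCircles

variable {D : DefectConditions}

/-- The `1`-cells. -/
abbrev Edge (U : DefectCircles D) : Type := Σ i, Fin (U.size i)

/-- The next `1`-cell on the same circle. -/
def next (U : DefectCircles D) (e : U.Edge) : U.Edge := ⟨e.1, finRotate _ e.2⟩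

/-- The empty object. -/
def empty (D : DefectConditions) : DefectCircles D where
  circles := 0
  size := fun i => i.elim0
  size_pos := fun i => i.elim0
  label := fun e => e.1.elim0

instance : IsEmpty (empty D).Edge := ⟨fun e => e.1.elim0⟩

end DefectCircles

/-- A bordism from `U` to `V` with defects and a PLCW decomposition: a surface with defects whose
boundary is identified, as a collection of oriented circles with defects, with `(-U) ⊔ V`. -/
structure Bordism {D : DefectConditions} (U V : DefectCircles D) where
  surface : PLCWSurface
  graph : DefectSurface surface D
  inSide : U.Edge → surface.Side
  outSide : V.Edge → surface.Side
  inSide_injective : Function.Injective inSide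
  outSide_injective : Function.Injective outSide
  inSide_ne_outSide : ∀ u v, inSide u ≠ outSide v
  boundary : ∀ s, surface.glue s = s ↔ (∃ u, inSide u = s) ∨ ∃ v, outSide v = s
  label_inSide : ∀ u, graph.label (surface.edge (inSide u)) = U.label u
  label_outSide : ∀ v, graph.label (surface.edge (outSide v)) = V.label v
  inSide_next : ∀ u, surface.Follows (inSide (U.next u)) (inSide u)
  outSide_next : ∀ v, surface.Follows (outSide v) (outSide (V.next v))

/-! ### The vector spaces -/

/-- The vector space `X = ℂ⟨a, b, c⟩`. -/
abbrev X : Type := Colour → ℂ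

/-- The basis `a, b, c` of `X`. -/
def basisX : Module.Basis Colour ℂ X := Pi.basisFun ℂ Colour

/-- The identification of the dual of `X` with `X` that sends `a*, b*, c*` to `a, b, c`. -/
def dualIso : Module.Dual ℂ X ≃ₗ[ℂ] X := basisX.toDualEquiv.symm

/-- The map `μ : X ⊗ X ⊗ X → ℂ` that takes a tensor of three basis vectors to `1` if they are all
different, and to `0` otherwise. -/
def mu : (⨂[ℂ] _ : Fin 3, X) →ₗ[ℂ] ℂ :=
  open Classical in
  (Basis.piTensorProduct (fun _ : Fin 3 => basisX)).constr ℂ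
    (fun x : Fin 3 → Colour => if Function.Injective x then (1 : ℂ) else 0)

/-- The space `R_e` of an undirected `1`-cell of an object: `ℂ` without defect, `X` with one. -/
def R {α : Type} : Option α → Type
  | none => ℂ
  | some _ => X

instance {α : Type} : ∀ ℓ : Option α, AddCommGroup (R ℓ)
  | none => inferInstanceAs (AddCommGroup ℂ)
  | some _ => inferInstanceAs (AddCommGroup X)

instance {α : Type} : ∀ ℓ : Option α, Module ℂ (R ℓ)
  | none => inferInstanceAs (Module ℂ ℂ)
  | some _ => inferInstanceAs (Module ℂ X)

/-- The space `Q_(P, e)` of a side: `ℂ` if it is not crossed by a `1`-stratum, and otherwise `X` or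
its dual, according to whether the `1`-stratum is oriented into or out of the polygon. -/
def Q {α : Type} : Option α → Bool → Type
  | none, _ => ℂ
  | some _, false => X
  | some _, true => Module.Dual ℂ X

instance {α : Type} : ∀ (ℓ : Option α) (o : Bool), AddCommGroup (Q ℓ o)
  | none, _ => inferInstanceAs (AddCommGroup ℂ)
  | some _, false => inferInstanceAs (AddCommGroup X)
  | some _, true => inferInstanceAs (AddCommGroup (Module.Dual ℂ X))

instance {α : Type} : ∀ (ℓ : Option α) (o : Bool), Module ℂ (Q ℓ o)
  | none, _ => inferInstanceAs (Module ℂ ℂ)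
  | some _, false => inferInstanceAs (Module ℂ X)
  | some _, true => inferInstanceAs (Module ℂ (Module.Dual ℂ X))

/-- The index set of the standard basis of `R ℓ` and `Q ℓ o`: a point, or the three colours. -/
def Idx {α : Type} : Option α → Type
  | none => Unit
  | some _ => Colour

instance {α : Type} : ∀ ℓ : Option α, Finite (Idx ℓ)
  | none => inferInstanceAs (Finite Unit)
  | some _ => inferInstanceAs (Finite Colour)

/-- The colour that a basis vector stands for; there is none if the `1`-cell has no defect. -/
def Idx.colour {α : Type} : ∀ {ℓ : Option α}, Idx ℓ → Option Colour
  | none, _ => none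
  | some _, x => some x

/-- The standard basis of `R ℓ`: `1`, or `a, b, c`. -/
def basisR {α : Type} : ∀ ℓ : Option α, Module.Basis (Idx ℓ) ℂ (R ℓ)
  | none => Module.Basis.singleton Unit ℂ
  | some _ => basisX

/-- The standard basis of `Q ℓ o`: `1`, or `a, b, c`, or the dual basis `a*, b*, c*`. -/
def basisQ {α : Type} : ∀ (ℓ : Option α) (o : Bool), Module.Basis (Idx ℓ) ℂ (Q ℓ o)
  | none, _ => Module.Basis.singleton Unit ℂ
  | some _, false => basisX
  | some _, true => basisX.dualBasis

/-- The identification `Q ℓ o ≃ R ℓ` coming from the identification of the dual of `X` with `X`. -/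
def forget {α : Type} : ∀ (ℓ : Option α) (o : Bool), Q ℓ o ≃ₗ[ℂ] R ℓ
  | none, _ => LinearEquiv.refl ℂ ℂ
  | some _, false => LinearEquiv.refl ℂ X
  | some _, true => dualIso

/-- Transport along an equality of labels. -/
def castR {α : Type} {ℓ ℓ' : Option α} (h : ℓ = ℓ') : R ℓ ≃ₗ[ℂ] R ℓ' := h ▸ LinearEquiv.refl ℂ (R ℓ)

/-- The scalar in the space of a side that is not crossed (and `0` for a side that is crossed). -/
def scalar {α : Type} : ∀ (ℓ : Option α) (o : Bool), Q ℓ o →ₗ[ℂ] ℂ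
  | none, _ => LinearMap.id
  | some _, _ => 0

/-- The vector of `X` given by a vector in the space of a side that is crossed, via the
identification of the dual of `X` with `X` (and `0` for a side that is not crossed). -/
def toX {α : Type} : ∀ (ℓ : Option α) (o : Bool), Q ℓ o →ₗ[ℂ] X
  | none, _ => 0
  | some _, false => LinearMap.id
  | some _, true => dualIso.toLinearMap

/-- The evaluation of the dual of `X` on `X`, for two sides where a `1`-stratum leaves and enters
(and `0` for all other pairs of sides). -/
def pairing {α : Type} : ∀ (ℓ : Option α) (o : Bool) (ℓ' : Option α) (o' : Bool), Q ℓ o →ₗ[ℂ] Q ℓ' o' →ₗ[ℂ] ℂ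
  | some _, true, some _, false => (LinearMap.id : Module.Dual ℂ X →ₗ[ℂ] Module.Dual ℂ X)
  | some _, false, some _, true => (LinearMap.id : Module.Dual ℂ X →ₗ[ℂ] Module.Dual ℂ X).flip
  | _, _, _, _ => 0

/-- The state space that `χ` assigns to an object: the tensor product of the `R_e`. -/
abbrev StateSpace (U : DefectCircles trivalent) : Type := ⨂[ℂ] e : U.Edge, R (U.label e)

/-- The standard basis of the state space: tensors of standard basis vectors of the `R_e`. -/
def stateBasis (U : DefectCircles trivalent) :
    Module.Basis (∀ e : U.Edge, Idx (U.label e)) ℂ (StateSpace U) :=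
  Basis.piTensorProduct (fun e => basisR (U.label e))

/-! ### Evaluation -/

/-- The evaluation of type II: `v*(w)` for the two crossed sides, times the scalars of the others. -/
def lineEval {α : Type} {n : ℕ} (ℓ : Fin n → Option α) (o : Fin n → Bool) (i j : Fin n) (hij : i < j) :
    MultilinearMap ℂ (fun k => Q (ℓ k) (o k)) ℂ where
  toFun v := pairing (ℓ i) (o i) (ℓ j) (o j) (v i) (v j) *
    ∏ k ∈ (Finset.univ.erase i).erase j, scalar (ℓ k) (o k) (v k)
  map_update_add' := by
    intro inst v m x y
    obtain rfl : inst = instDecidableEqFin n := Subsingleton.elim _ _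
    have hne : i ≠ j := hij.ne
    by_cases hi : m = i
    · subst hi
      have h : ∀ z, (∏ k ∈ (Finset.univ.erase m).erase j,
          scalar (ℓ k) (o k) (Function.update v m z k)) =
          ∏ k ∈ (Finset.univ.erase m).erase j, scalar (ℓ k) (o k) (v k) := fun z =>
        Finset.prod_congr rfl fun k hk => by
          rw [Function.update_of_ne (Finset.ne_of_mem_erase (Finset.mem_of_mem_erase hk))]
      simp only [h, Function.update_self, Function.update_of_ne hne.symm, map_add,
        LinearMap.add_apply, add_mul]
    by_cases hj : m = j
    · subst hj
      have h : ∀ z, (∏ k ∈ (Finset.univ.erase i).erase m,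
          scalar (ℓ k) (o k) (Function.update v m z k)) =
          ∏ k ∈ (Finset.univ.erase i).erase m, scalar (ℓ k) (o k) (v k) := fun z =>
        Finset.prod_congr rfl fun k hk => by
          rw [Function.update_of_ne (Finset.ne_of_mem_erase hk)]
      simp only [h, Function.update_self, Function.update_of_ne hne, map_add, add_mul]
    have hm : m ∈ (Finset.univ.erase i).erase j :=
      Finset.mem_erase.2 ⟨hj, Finset.mem_erase.2 ⟨hi, Finset.mem_univ m⟩⟩
    have h : ∀ z, (∏ k ∈ (Finset.univ.erase i).erase j,
        scalar (ℓ k) (o k) (Function.update v m z k)) = scalar (ℓ m) (o m) z *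
        ∏ k ∈ ((Finset.univ.erase i).erase j).erase m, scalar (ℓ k) (o k) (v k) := fun z => by
      rw [← Finset.mul_prod_erase _ _ hm, Function.update_self]
      congr 1
      exact Finset.prod_congr rfl fun k hk => by
        rw [Function.update_of_ne (Finset.ne_of_mem_erase hk)]
    simp only [h, Function.update_of_ne (Ne.symm hi), Function.update_of_ne (Ne.symm hj), map_add]
    ring
  map_update_smul' := by
    intro inst v m r x
    obtain rfl : inst = instDecidableEqFin n := Subsingleton.elim _ _
    have hne : i ≠ j := hij.ne
    by_cases hi : m = i
    · subst hi
      have h : ∀ z, (∏ k ∈ (Finset.univ.erase m).erase j,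
          scalar (ℓ k) (o k) (Function.update v m z k)) =
          ∏ k ∈ (Finset.univ.erase m).erase j, scalar (ℓ k) (o k) (v k) := fun z =>
        Finset.prod_congr rfl fun k hk => by
          rw [Function.update_of_ne (Finset.ne_of_mem_erase (Finset.mem_of_mem_erase hk))]
      simp only [h, Function.update_self, Function.update_of_ne hne.symm, map_smul,
        LinearMap.smul_apply, smul_mul_assoc]
    by_cases hj : m = j
    · subst hj
      have h : ∀ z, (∏ k ∈ (Finset.univ.erase i).erase m,
          scalar (ℓ k) (o k) (Function.update v m z k)) =
          ∏ k ∈ (Finset.univ.erase i).erase m, scalar (ℓ k) (o k) (v k) := fun z =>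
        Finset.prod_congr rfl fun k hk => by
          rw [Function.update_of_ne (Finset.ne_of_mem_erase hk)]
      simp only [h, Function.update_self, Function.update_of_ne hne, map_smul, smul_mul_assoc]
    have hm : m ∈ (Finset.univ.erase i).erase j :=
      Finset.mem_erase.2 ⟨hj, Finset.mem_erase.2 ⟨hi, Finset.mem_univ m⟩⟩
    have h : ∀ z, (∏ k ∈ (Finset.univ.erase i).erase j,
        scalar (ℓ k) (o k) (Function.update v m z k)) = scalar (ℓ m) (o m) z *
        ∏ k ∈ ((Finset.univ.erase i).erase j).erase m, scalar (ℓ k) (o k) (v k) := fun z => by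
      rw [← Finset.mul_prod_erase _ _ hm, Function.update_self]
      congr 1
      exact Finset.prod_congr rfl fun k hk => by
        rw [Function.update_of_ne (Finset.ne_of_mem_erase hk)]
    simp only [h, Function.update_of_ne (Ne.symm hi), Function.update_of_ne (Ne.symm hj), map_smul,
      smul_eq_mul]
    ring

/-- The evaluation `ℰ_P` of a polygon with labels `ℓ` and orientations `o` at its sides: the
product of scalars (type I), the evaluation of the dual of `X` on `X` (type II), `μ` (type III). -/
def patternEval {α : Type} {n : ℕ} (ℓ : Fin n → Option α) (o : Fin n → Bool) :
    ∀ p : CellPattern n, (p = .star → n = 3) → MultilinearMap ℂ (fun k => Q (ℓ k) (o k)) ℂ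
  | .empty, _ => (MultilinearMap.mkPiAlgebra ℂ (Fin n) ℂ).compLinearMap
      (fun k => scalar (ℓ k) (o k))
  | .line i j h, _ => lineEval ℓ o i j h
  | .star, h => ((PiTensorProduct.lift.symm mu).domDomCongr (finCongr (h rfl).symm)).compLinearMap
      (fun k => toX (ℓ k) (o k))

theorem prodForms_update (S : PLCWSurface) (W : S.Side → Type) [∀ s, AddCommGroup (W s)]
    [∀ s, Module ℂ (W s)] (E : ∀ P, MultilinearMap ℂ (fun i => W ⟨P, i⟩) ℂ) [DecidableEq S.Side]
    (v : ∀ s, W s) (P : S.Cell) (i : Fin (S.size P)) (z : W ⟨P, i⟩) :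
    (∏ P', E P' (fun k => Function.update v ⟨P, i⟩ z ⟨P', k⟩)) =
      E P (Function.update (fun k => v ⟨P, k⟩) i z) *
        ∏ P' ∈ Finset.univ.erase P, E P' (fun k => v ⟨P', k⟩) := by
  rw [← Finset.mul_prod_erase _ _ (Finset.mem_univ P)]
  congr 1
  · congr 1
    funext k
    by_cases hk : k = i
    · subst hk
      rw [Function.update_self, Function.update_self]
    · rw [Function.update_of_ne hk, Function.update_of_ne]
      intro h
      exact hk (by simpa using h)
  · refine Finset.prod_congr rfl fun P' hP' => ?_
    congr 1
    funext k
    rw [Function.update_of_ne]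
    intro h
    exact Finset.ne_of_mem_erase hP' (congrArg Sigma.fst h)

/-- The tensor product over all `2`-cells `P` of multilinear forms on the sides of `P`. -/
def prodForms (S : PLCWSurface) (W : S.Side → Type) [∀ s, AddCommGroup (W s)]
    [∀ s, Module ℂ (W s)] (E : ∀ P, MultilinearMap ℂ (fun i => W ⟨P, i⟩) ℂ) :
    MultilinearMap ℂ W ℂ where
  toFun v := ∏ P, E P (fun i => v ⟨P, i⟩)
  map_update_add' := by
    rintro _ v ⟨P, i⟩ x y
    simp only [prodForms_update, MultilinearMap.map_update_add, add_mul]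
  map_update_smul' := by
    rintro _ v ⟨P, i⟩ r x
    simp only [prodForms_update, MultilinearMap.map_update_smul, smul_mul_assoc]

/-! ### The lattice topological field theory -/

namespace Bordism

variable {U V : DefectCircles trivalent} (M : Bordism U V) (o : M.graph.Orientation)

/-- The `1`-cells that do not lie on the in-boundary. -/
abbrev FreeCell : Type := {e : M.surface.OneCell // ∀ u, M.surface.edge (M.inSide u) ≠ e}

/-- The sides that do not lie on the in-boundary. -/
abbrev FreeSide : Type := {s : M.surface.Side // ∀ u, M.surface.edge (M.inSide u) ≠ M.surface.edge s}

/-- The `1`-cell of a free side. -/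
def freeEdge (s : M.FreeSide) : M.FreeCell := ⟨M.surface.edge s.1, s.2⟩

/-- The `1`-cell of an out-boundary side. -/
def outEdge (v : V.Edge) : M.FreeCell :=
  ⟨M.surface.edge (M.outSide v), fun u h => by
    rcases M.surface.edge_eq_edge.1 h with h | h
    · exact M.inSide_ne_outSide u v h
    · rw [(M.boundary _).2 (Or.inr ⟨v, rfl⟩)] at h
      exact M.inSide_ne_outSide u v h⟩

/-- The space `Q_(P, e)` of a side. -/
abbrev SideSpace (s : M.surface.Side) : Type := Q (M.graph.label (M.surface.edge s)) (o.out s)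

/-- The state space of the in-boundary for the chosen orientation. -/
abbrev InSpace : Type := ⨂[ℂ] u : U.Edge, M.SideSpace o (M.inSide u)

/-- The state space of the out-boundary for the chosen orientation: for each side the space dual to
`Q_(P, e)`. -/
abbrev OutSpace : Type :=
  ⨂[ℂ] v : V.Edge, Q (M.graph.label (M.surface.edge (M.outSide v))) (!o.out (M.outSide v))

/-- The space `Q(Σ)`. -/
abbrev QSpace : Type := ⨂[ℂ] s : M.FreeSide, M.SideSpace o s.1

/-- A choice of a basis vector for every `1`-cell that does not lie on the in-boundary. -/
abbrev Choice : Type := ∀ e : M.FreeCell, Idx (M.graph.label e.1)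

instance : Fintype M.Choice := Fintype.ofFinite _

/-- The propagator: the tensor product over the `1`-cells not on the in-boundary of the copairings
`λ ↦ λ ∑ᵢ vᵢ ⊗ vᵢ*`, whose two factors belong to the two sides of an interior `1`-cell, and to the
side and to the out-boundary for a `1`-cell on the out-boundary.  The product of sums is multiplied
out. -/
def propagator : ℂ →ₗ[ℂ] M.QSpace o ⊗[ℂ] M.OutSpace o :=
  LinearMap.toSpanSingleton ℂ _
    (∑ x : M.Choice,
      (PiTensorProduct.tprod ℂ fun s : M.FreeSide => basisQ _ (o.out s.1) (x (M.freeEdge s))) ⊗ₜ[ℂ]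
      (PiTensorProduct.tprod ℂ fun v : V.Edge =>
        basisQ _ (!o.out (M.outSide v)) (x (M.outEdge v))))

/-- Every side either lies on the in-boundary or is free. -/
def sideEquiv : U.Edge ⊕ M.FreeSide ≃ M.surface.Side :=
  Equiv.ofBijective (Sum.elim M.inSide Subtype.val) (by
    constructor
    · rintro (u | s) (u' | s') h
      · exact congrArg Sum.inl (M.inSide_injective h)
      · exact (s'.2 u (congrArg M.surface.edge h)).elim
      · exact (s.2 u' (congrArg M.surface.edge h.symm)).elim
      · exact congrArg Sum.inr (Subtype.ext h)
    · intro s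
      by_cases hs : ∀ u, M.surface.edge (M.inSide u) ≠ M.surface.edge s
      · exact ⟨Sum.inr ⟨s, hs⟩, rfl⟩
      · obtain ⟨u, hu⟩ := not_forall_not.1 hs
        refine ⟨Sum.inl u, ?_⟩
        rcases M.surface.edge_eq_edge.1 hu.symm with h | h
        · exact h.symm
        · exact ((h.trans ((M.boundary _).2 (Or.inl ⟨u, rfl⟩)))).symm)

/-- The evaluation `ℰ(Σ) = ⨂_P ℰ_P` on the tensor product of the in-boundary state space and
`Q(Σ)`, which together contain one factor `Q_(P, e)` for each side. -/
def evaluation : M.InSpace o ⊗[ℂ] M.QSpace o →ₗ[ℂ] ℂ :=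
  PiTensorProduct.lift
      (prodForms M.surface (M.SideSpace o) (fun P =>
        patternEval _ _ (M.graph.pattern P) (M.graph.size_of_star P)))
    ∘ₗ (PiTensorProduct.reindex ℂ (M.SideSpace o) M.sideEquiv.symm).symm.toLinearMap
    ∘ₗ (PiTensorProduct.tmulEquivDep ℂ
      (fun x : U.Edge ⊕ M.FreeSide => M.SideSpace o (M.sideEquiv x))).toLinearMap

/-- The linear map of a bordism, for the chosen orientation of the `1`-strata. -/
def chiDirected : M.InSpace o →ₗ[ℂ] M.OutSpace o :=
  (TensorProduct.lid ℂ (M.OutSpace o)).toLinearMap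
    ∘ₗ (M.evaluation o).rTensor (M.OutSpace o)
    ∘ₗ (TensorProduct.assoc ℂ (M.InSpace o) (M.QSpace o) (M.OutSpace o)).symm.toLinearMap
    ∘ₗ (M.propagator o).lTensor (M.InSpace o)
    ∘ₗ (TensorProduct.rid ℂ (M.InSpace o)).symm.toLinearMap

/-- The linear map `χ(M) : χ(U) → χ(V)`, computed with the orientation `o` of the `1`-strata and the
identification of the dual of `X` with `X`. -/
def chi : StateSpace U →ₗ[ℂ] StateSpace V :=
  (PiTensorProduct.congr fun v =>
      (forget _ (!o.out (M.outSide v))).trans (castR (M.label_outSide v))).toLinearMap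
    ∘ₗ M.chiDirected o
    ∘ₗ (PiTensorProduct.congr fun u =>
      (castR (M.label_inSide u).symm).trans (forget _ (o.out (M.inSide u))).symm).toLinearMap

/-- The boundary colouring induced on the out-boundary by a `3`-edge-colouring. -/
def outColour (s : M.graph.Colouring) (v : V.Edge) : Option Colour :=
  s.1.label (M.surface.edge (M.outSide v))

end Bordism

/-- The vector `χ(M)(1)` that `χ` assigns to a bordism from the empty object, whose state space is
`ℂ`. -/
def chiVector {V : DefectCircles trivalent} (M : Bordism (DefectCircles.empty trivalent) V)
    (o : M.graph.Orientation) : StateSpace V :=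
  M.chi o ((PiTensorProduct.isEmptyEquiv _).symm 1)

/-! ### Basic-gons -/

/-- A basic-gon for undirected trivalent graphs: an `n`-gon with one of the three patterns of
strata. -/
structure BasicGon where
  size : ℕ
  size_pos : 0 < size
  graph : DefectSurface (PLCWSurface.polygon size size_pos) trivalent

namespace BasicGon

variable (P : BasicGon)

/-- The boundary circle of a basic-gon. -/
def boundary : DefectCircles trivalent where
  circles := 1
  size := fun _ => P.size
  size_pos := fun _ => P.size_pos
  label := fun e => P.graph.label (PLCWSurface.edge _ ⟨(), e.2⟩)

/-- A basic-gon viewed as a cup, a bordism from the empty object to its boundary circle. -/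
def cup : Bordism (DefectCircles.empty trivalent) P.boundary where
  surface := PLCWSurface.polygon P.size P.size_pos
  graph := P.graph
  inSide := fun u => isEmptyElim u
  outSide := fun e => ⟨(), e.2⟩
  inSide_injective := fun u => isEmptyElim u
  outSide_injective := by
    rintro ⟨i, k⟩ ⟨i', k'⟩ h
    obtain rfl : i = i' := Subsingleton.elim (α := Fin 1) i i'
    have hk : k = k' := eq_of_heq (Sigma.mk.inj h).2
    rw [hk]
  inSide_ne_outSide := fun u => isEmptyElim u
  boundary := fun s => ⟨fun _ => Or.inr ⟨⟨(0 : Fin 1), s.2⟩, rfl⟩, fun _ => rfl⟩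
  label_inSide := fun u => isEmptyElim u
  label_outSide := fun _ => rfl
  inSide_next := fun u => isEmptyElim u
  outSide_next := fun _ => PLCWSurface.Follows.base

end BasicGon

end TaitTFT

end

open TaitTFT

open scoped TensorProduct

namespace TaitTFT

/-! ### Basis vectors -/

/-! Both sides are the same number, `0` or `1`, decided by whether the colours of `w` fit the
stratification of `P` under the Klein four-group conditions. On the analytic side, a single polygon
with nothing glued has all its `1`-cells on the out-boundary. A term of the propagator is therefore
a basis vector of the boundary, paired with the matching tensor in the spaces of the sides.
Evaluation consumes the latter and leaves the former, so the coefficient at `w` is the evaluation of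
the polygon on the basis vectors named by `w` (`repr_chiVector`). By `patternEval_basisQ` this is
`1` if the colours fit and `0` if not: nothing to check for the empty graph, equal colours at both
ends of a line, three different colours around a vertex. On the combinatorial side, every stratum of
a basic-gon reaches the boundary, so a colouring is determined by its boundary colours and exists
exactly when these fit (`card_colouring`). Orientations do not matter, because the dual basis of `X`
is sent to the basis itself and a line leaves the polygon at one end and enters it at the other. -/

theorem dualIso_dualBasis (x : Colour) : dualIso (basisX.dualBasis x) = basisX x := by
  rw [dualIso, LinearEquiv.symm_apply_eq, Module.Basis.toDualEquiv_apply]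
  refine basisX.ext fun y => ?_
  rw [Module.Basis.toDual_apply, Module.Basis.dualBasis_apply_self]
  simp only [eq_comm]

theorem forget_basisQ {α : Type} (ℓ : Option α) (o : Bool) (x : Idx ℓ) :
    forget ℓ o (basisQ ℓ o x) = basisR ℓ x := by
  cases ℓ with
  | none => rfl
  | some _ =>
    cases o
    · rfl
    · exact dualIso_dualBasis x

theorem scalar_basisQ {α : Type} {ℓ : Option α} (h : ℓ = none) (o : Bool) (x : Idx ℓ) :
    scalar ℓ o (basisQ ℓ o x) = 1 := by
  subst h
  exact Module.Basis.singleton_apply Unit ℂ x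

theorem colour_eq_none {α : Type} {ℓ : Option α} (h : ℓ = none) (x : Idx ℓ) : x.colour = none := by
  subst h
  rfl

/-- The colour `y` is chosen before the orientation `o`: this is what makes the evaluation at a
vertex independent of orientations. -/
theorem exists_colour {α : Type} {ℓ : Option α} {t : α} (h : ℓ = some t) (x : Idx ℓ) :
    ∃ y, x.colour = some y ∧ ∀ o, toX ℓ o (basisQ ℓ o x) = basisX y := by
  subst h
  refine ⟨x, rfl, fun o => ?_⟩
  cases o
  · rfl
  · exact dualIso_dualBasis x

/-- A basis index carries a colour exactly where there is a defect. This is what makes the colouring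
built from boundary data bleach to the given graph. -/
theorem map_colour {α : Type} {ℓ : Option α} (x : Idx ℓ) :
    x.colour.map (fun _ => ()) = ℓ.map fun _ => () := by
  cases ℓ <;> rfl

/-- The two orientations must be opposite, since otherwise `pairing` is `0` by definition. What
remains is the duality of the two bases, with the dual vector at whichever end the line leaves. -/
theorem pairing_basisQ {α : Type} {ℓ ℓ' : Option α} {t t' : α} (h : ℓ = some t) (h' : ℓ' = some t')
    (o : Bool) (x : Idx ℓ) (x' : Idx ℓ') :
    pairing ℓ o ℓ' (!o) (basisQ ℓ o x) (basisQ ℓ' (!o) x') =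
      if x.colour = x'.colour then 1 else 0 := by
  subst h h'
  change Colour at x x'
  have hc : (if Idx.colour (ℓ := some t) x = Idx.colour (ℓ := some t') x' then (1 : ℂ) else 0) =
      if x = x' then 1 else 0 :=
    if_congr ⟨fun h => Option.some.inj h, fun h => congrArg some h⟩ rfl rfl
  have key : ∀ y y' : Colour, basisX.dualBasis y (basisX y') = if y' = y then 1 else 0 :=
    fun y y' => Module.Basis.dualBasis_apply_self _ _ _
  refine Eq.trans ?_ hc.symm
  cases o
  · exact key x' x
  · exact (key x x').trans (if_congr eq_comm rfl rfl)

theorem mu_tprod (f : Fin 3 → Colour) [Decidable (Function.Injective f)] :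
    mu (PiTensorProduct.tprod ℂ fun k => basisX (f k)) = if Function.Injective f then 1 else 0 := by
  rw [← Basis.piTensorProduct_apply (fun _ : Fin 3 => basisX) f, mu, Module.Basis.constr_basis]
  -- The two sides differ only in the decidability instance: `mu` was defined with the classical
  -- one.
  congr

/-! ### Evaluation of a polygon on basis vectors -/

/-- The relators `a²`, `b²`, `c²` have the wrong length. The rotations of `abc` and of its reversal
are all six orderings of the three colours. -/
theorem ofFn_mem_kleinFour_words (f : Fin 3 → Colour) :
    ((List.ofFn f : List Colour) : Cycle Colour) ∈ kleinFour.words ↔ Function.Injective f := by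
  have h : ((List.ofFn f : List Colour) : Cycle Colour) ∈ kleinFour.words ↔
      ∃ r ∈ [[Colour.a, Colour.a], [Colour.b, Colour.b], [Colour.c, Colour.c],
        [Colour.a, Colour.b, Colour.c]], ((List.ofFn f : List Colour) : Cycle Colour) = r ∨
          ((List.ofFn f : List Colour) : Cycle Colour) = (r.reverse : List Colour) := by
    -- Listing the relators, instead of taking them from a set, turns the claim into a finite check
    -- over the 27 maps `f`.
    simp only [List.mem_cons, List.not_mem_nil, or_false]
    rfl
  rw [h]
  clear h
  revert f
  decide

/-- Uncrossed sides carry the basis vector `1` of `ℂ` and contribute nothing, so only the crossed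
sides matter: the duality of bases decides type II, and `mu` decides type III. -/
theorem patternEval_basisQ {n : ℕ} (ℓ : Fin n → Option Unit) (o : Fin n → Bool)
    (p : CellPattern n) (hs : p = .star → n = 3) (hp : p.Valid trivalent ℓ)
    (ho : ∀ i j h, p = .line i j h → o j = !o i) (x : ∀ k, Idx (ℓ k))
    [Decidable (p.Valid kleinFour fun k => (x k).colour)] :
    patternEval ℓ o p hs (fun k => basisQ (ℓ k) (o k) (x k)) =
      if p.Valid kleinFour fun k => (x k).colour then 1 else 0 := by
  cases p with
  | empty =>
    have hv : (CellPattern.empty : CellPattern n).Valid kleinFour fun k => (x k).colour :=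
      fun k => colour_eq_none (hp k) (x k)
    rw [if_pos hv]
    exact (MultilinearMap.mkPiAlgebra_apply (R := ℂ) (ι := Fin n) (A := ℂ) _).trans
      (Finset.prod_eq_one fun k _ => scalar_basisQ (hp k) _ _)
  | line i j h =>
    obtain ⟨t, hi, hj, hk⟩ := hp
    have hv : (CellPattern.line i j h).Valid kleinFour (fun k => (x k).colour) ↔
        (x i).colour = (x j).colour := by
      obtain ⟨y, hy, -⟩ := exists_colour hi (x i)
      constructor
      · rintro ⟨z, h1, h2, -⟩
        exact h1.trans h2.symm
      · exact fun e => ⟨y, hy, e.symm.trans hy, fun k h1 h2 => colour_eq_none (hk k h1 h2) _⟩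
    have hprod : (∏ k ∈ (Finset.univ.erase i).erase j,
        scalar (ℓ k) (o k) (basisQ (ℓ k) (o k) (x k))) = 1 :=
      Finset.prod_eq_one fun k hm => scalar_basisQ
        (hk k (Finset.ne_of_mem_erase (Finset.mem_of_mem_erase hm)) (Finset.ne_of_mem_erase hm)) _ _
    have hpair := pairing_basisQ hi hj (o i) (x i) (x j)
    rw [← ho i j h rfl] at hpair
    rw [if_congr hv rfl rfl, ← hpair]
    exact (congrArg _ hprod).trans (mul_one _)
  | star =>
    obtain rfl := hs rfl
    obtain ⟨g, hg, -⟩ := hp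
    choose y hy hX using fun k => exists_colour (hg k) (x k)
    have hv : CellPattern.star.Valid kleinFour (fun k => (x k).colour) ↔ Function.Injective y := by
      rw [← ofFn_mem_kleinFour_words]
      constructor
      · rintro ⟨f, hf, hw⟩
        obtain rfl : f = y := funext fun k => Option.some.inj ((hf k).symm.trans (hy k))
        exact hw
      · exact fun hw => ⟨y, hy, hw⟩
    classical
    rw [if_congr hv rfl rfl, ← mu_tprod]
    -- Once `n` is literally `3`, the reindexing in `patternEval` is the identity by definition, and
    -- only the three vectors have to be compared.
    refine congrArg (fun v : Fin 3 → X => mu (PiTensorProduct.tprod ℂ v)) (funext fun k => ?_)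
    exact hX k (o k)

/-! ### The vector of a bordism from the empty object -/

variable {V : DefectCircles trivalent} (M : Bordism (DefectCircles.empty trivalent) V)
  (o : M.graph.Orientation)

/-- The basis element that a choice assigns to a side of a bordism from the empty object. -/
def Bordism.sideIdx (x : M.Choice) (s : M.surface.Side) : Idx (M.graph.label (M.surface.edge s)) :=
  x ⟨M.surface.edge s, fun u => isEmptyElim u⟩

/-- With no in-boundary, every side is free and the tensor of `f` has no factors. Regrouping the
factors thus gives the pure tensor over all sides, on which the evaluation is a product over
`2`-cells. -/
theorem evaluation_basis (x : M.Choice) (f : ∀ u, M.SideSpace o (M.inSide u)) :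
    M.evaluation o (PiTensorProduct.tprod ℂ f ⊗ₜ[ℂ]
      PiTensorProduct.tprod ℂ fun s : M.FreeSide => basisQ _ (o.out s.1) (x (M.freeEdge s))) =
    ∏ P, patternEval (fun i => M.graph.label (M.surface.edge ⟨P, i⟩)) (fun i => o.out ⟨P, i⟩)
      (M.graph.pattern P) (M.graph.size_of_star P)
      (fun i => basisQ _ (o.out ⟨P, i⟩) (M.sideIdx x ⟨P, i⟩)) := by
  have h : PiTensorProduct.tmulEquivDep ℂ
      (fun x : (DefectCircles.empty trivalent).Edge ⊕ M.FreeSide => M.SideSpace o (M.sideEquiv x))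
      (PiTensorProduct.tprod ℂ f ⊗ₜ[ℂ]
      PiTensorProduct.tprod ℂ fun s : M.FreeSide => basisQ _ (o.out s.1) (x (M.freeEdge s))) =
      PiTensorProduct.reindex ℂ (M.SideSpace o) M.sideEquiv.symm
        (PiTensorProduct.tprod ℂ fun s => basisQ _ (o.out s) (M.sideIdx x s)) := by
    refine (PiTensorProduct.tmulEquivDep_apply _ _ _ _).trans
      (Eq.trans ?_ (PiTensorProduct.reindex_tprod (R := ℂ) (s := M.SideSpace o) M.sideEquiv.symm
        fun s => basisQ _ (o.out s) (M.sideIdx x s)).symm)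
    refine congrArg (PiTensorProduct.tprod ℂ) (funext fun i => ?_)
    cases i with
    | inl u => exact isEmptyElim u
    | inr s => rfl
  exact (congrArg (fun t => PiTensorProduct.lift _
    ((PiTensorProduct.reindex ℂ (M.SideSpace o) M.sideEquiv.symm).symm t)) h).trans
      ((congrArg _ (LinearEquiv.symm_apply_apply _ _)).trans (PiTensorProduct.lift.tprod _))

/-- Each term of the multiplied-out propagator is a pure tensor: the evaluation turns its first half
into a scalar, and forgetting orientations turns its second half into standard basis vectors. -/
theorem chiVector_eq_sum :
    chiVector M o = ∑ x : M.Choice,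
      (∏ P, patternEval (fun i => M.graph.label (M.surface.edge ⟨P, i⟩)) (fun i => o.out ⟨P, i⟩)
        (M.graph.pattern P) (M.graph.size_of_star P)
        (fun i => basisQ _ (o.out ⟨P, i⟩) (M.sideIdx x ⟨P, i⟩))) •
      PiTensorProduct.tprod ℂ fun v => castR (M.label_outSide v) (basisR _ (x (M.outEdge v))) := by
  -- Under the identification of the empty tensor product with `ℂ`, the scalar `1` is the pure
  -- tensor of the empty family.
  have h1 : (PiTensorProduct.isEmptyEquiv (DefectCircles.empty trivalent).Edge
      (R := ℂ) (s := fun e => R ((DefectCircles.empty trivalent).label e))).symm 1 =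
      PiTensorProduct.tprod ℂ fun u => isEmptyElim u := by
    rw [LinearEquiv.symm_apply_eq, PiTensorProduct.isEmptyEquiv_apply_tprod]
  rw [chiVector, h1, Bordism.chi, LinearMap.comp_apply, LinearMap.comp_apply]
  simp only [LinearEquiv.coe_coe]
  erw [PiTensorProduct.congr_tprod]
  rw [Bordism.chiDirected]
  simp only [LinearMap.comp_apply, LinearEquiv.coe_coe, TensorProduct.rid_symm_apply,
    LinearMap.lTensor_tmul, Bordism.propagator, LinearMap.toSpanSingleton_apply, one_smul,
    TensorProduct.tmul_sum, map_sum, TensorProduct.assoc_symm_tmul, LinearMap.rTensor_tmul,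
    evaluation_basis, TensorProduct.lid_tmul, map_smul]
  refine Finset.sum_congr rfl fun x _ => ?_
  congr 1
  erw [PiTensorProduct.congr_tprod]
  congr 1
  funext v
  exact congrArg (castR (M.label_outSide v)) (forget_basisQ _ _ _)

/-! ### Basic-gons -/

namespace BasicGon

variable (P : BasicGon)

/-- The gluing of a polygon is the identity, so both ways for two sides to be the same `1`-cell say
that they are equal. -/
theorem edge_injective :
    Function.Injective (PLCWSurface.edge (PLCWSurface.polygon P.size P.size_pos)) := by
  intro s t h
  rcases (PLCWSurface.edge_eq_edge _).1 h with h | h <;> exact h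

/-- The choices of basis vectors on a basic-gon are the basis vectors of its boundary. -/
theorem outEdge_bijective : Function.Bijective P.cup.outEdge := by
  constructor
  · intro v v' h
    exact P.cup.outSide_injective (P.edge_injective (congrArg Subtype.val h))
  · rintro ⟨e, he⟩
    induction e using Quotient.inductionOn with
    | _ s => exact ⟨⟨(0 : Fin 1), s.2⟩, rfl⟩

theorem repr_chiVector (o : P.cup.graph.Orientation)
    (w : ∀ e : P.boundary.Edge, Idx (P.boundary.label e)) :
    (stateBasis P.boundary).repr (chiVector P.cup o) w =
      patternEval (fun i => P.graph.label (PLCWSurface.edge _ ⟨(), i⟩)) (fun i => o.out ⟨(), i⟩)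
        (P.graph.pattern ()) (P.graph.size_of_star ())
        (fun i => basisQ _ (o.out ⟨(), i⟩) (w ⟨(0 : Fin 1), i⟩)) := by
  classical
  have hb : ∀ x : P.cup.Choice,
      (PiTensorProduct.tprod ℂ fun v =>
        castR (P.cup.label_outSide v) (basisR _ (x (P.cup.outEdge v)))) =
      stateBasis P.boundary fun v => x (P.cup.outEdge v) := fun x =>
    (Basis.piTensorProduct_apply (fun e => basisR (P.boundary.label e)) _).symm
  -- `E w` is `w` read as a choice on the `1`-cells of the polygon. It is the only choice whose term
  -- has a nonzero coordinate at `w`.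
  let E := Equiv.piCongrLeft (fun e : P.cup.FreeCell => Idx (P.cup.graph.label e.1))
    (Equiv.ofBijective _ P.outEdge_bijective)
  have hE : ∀ v, E w (P.cup.outEdge v) = w v := fun v =>
    Equiv.piCongrLeft_apply_apply (fun e : P.cup.FreeCell => Idx (P.cup.graph.label e.1))
      (Equiv.ofBijective _ P.outEdge_bijective) w v
  have hrepr : ∀ x : P.cup.Choice, (stateBasis P.boundary).repr
      (stateBasis P.boundary fun v => x (P.cup.outEdge v)) w = if x = E w then 1 else 0 := by
    intro x
    refine (Module.Basis.repr_self_apply _ _ _).trans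
      (if_congr ⟨fun h => funext fun e => ?_, fun h => funext fun v => ?_⟩ rfl rfl)
    · obtain ⟨v, rfl⟩ := P.outEdge_bijective.2 e
      exact (congrFun h v).trans (hE v).symm
    · exact (congrFun h _).trans (hE v)
  rw [chiVector_eq_sum]
  simp only [hb, map_sum, map_smul, Finsupp.coe_finsetSum, Finset.sum_apply, Finsupp.smul_apply,
    smul_eq_mul]
  simp_rw [hrepr]
  rw [Fintype.sum_eq_single (E w) fun x hx => by rw [if_neg hx, mul_zero], if_pos rfl, mul_one]
  refine (Fintype.prod_unique (ι := Unit) _).trans (congrArg _ (funext fun i => ?_))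
  exact congrArg (basisQ _ _) (hE ⟨(0 : Fin 1), i⟩)

/-- Bleaching fixes the pattern and every `1`-cell lies on the boundary, so the boundary colours
leave no freedom. The only condition left for existence is validity on the one `2`-cell. -/
theorem card_colouring (w : ∀ e : P.boundary.Edge, Idx (P.boundary.label e))
    [Decidable ((P.graph.pattern ()).Valid kleinFour fun i => (w ⟨(0 : Fin 1), i⟩).colour)] :
    Nat.card {s : P.cup.graph.Colouring // ∀ e, P.cup.outColour s e = (w e).colour} =
      if (P.graph.pattern ()).Valid kleinFour fun i => (w ⟨(0 : Fin 1), i⟩).colour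
      then 1 else 0 := by
  have hlabel : ∀ s : P.cup.graph.Colouring, (∀ e, P.cup.outColour s e = (w e).colour) →
      ∀ i, s.1.label (PLCWSurface.edge _ ⟨(), i⟩) = (w ⟨(0 : Fin 1), i⟩).colour :=
    fun s h i => h ⟨(0 : Fin 1), i⟩
  have hpattern : ∀ s : P.cup.graph.Colouring, s.1.pattern = P.graph.pattern :=
    fun s => congrArg DefectSurface.pattern s.2
  split_ifs with hv
  · rw [Nat.card_eq_one_iff_unique]
    constructor
    · constructor
      rintro ⟨s, hs⟩ ⟨t, ht⟩
      refine Subtype.ext (Subtype.ext (DefectSurface.ext (funext fun e => ?_)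
        ((hpattern s).trans (hpattern t).symm)))
      induction e using Quotient.inductionOn with
      | _ r => exact (hlabel s hs r.2).trans (hlabel t ht r.2).symm
    -- The default `none` is never used: every `1`-cell comes from a side.
    · let L := Function.extend (PLCWSurface.edge (PLCWSurface.polygon P.size P.size_pos))
        (fun s => (w ⟨(0 : Fin 1), s.2⟩).colour) (fun _ => none)
      have hL : ∀ s, L (PLCWSurface.edge _ s) = (w ⟨(0 : Fin 1), s.2⟩).colour :=
        P.edge_injective.extend_apply _ _
      refine ⟨⟨⟨⟨L, P.graph.pattern, fun _ => ?_⟩, DefectSurface.ext (funext fun e => ?_) rfl⟩,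
        fun ⟨i, k⟩ => ?_⟩⟩
      · have h := hv
        rwa [← show (fun i => L (PLCWSurface.edge _ ⟨(), i⟩)) =
          fun i => (w ⟨(0 : Fin 1), i⟩).colour from funext fun i => hL ⟨(), i⟩] at h
      · induction e using Quotient.inductionOn with
        | _ r => exact (congrArg (Option.map _) (hL r)).trans (map_colour _)
      · obtain rfl : i = (0 : Fin 1) := Subsingleton.elim (α := Fin 1) i 0
        exact hL ⟨(), k⟩
  · rw [Nat.card_eq_zero]
    refine Or.inl ⟨fun ⟨s, hs⟩ => hv ?_⟩
    have h := s.1.valid ()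
    rwa [hpattern s, show (fun i => s.1.label (PLCWSurface.edge _ ⟨(), i⟩)) =
      fun i => (w ⟨(0 : Fin 1), i⟩).colour from funext (hlabel s hs)] at h

end BasicGon

end TaitTFT

open TaitTFT
theorem mainTheorem11 (P : BasicGon) (o : P.cup.graph.Orientation)
    (w : ∀ e : P.boundary.Edge, Idx (P.boundary.label e)) :
    (stateBasis P.boundary).repr (chiVector P.cup o) w =
      (Nat.card {s : P.cup.graph.Colouring // ∀ e, P.cup.outColour s e = (w e).colour} : ℂ) := by
  classical
  rw [P.repr_chiVector, P.card_colouring]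
  -- The condition `out_line` supplies the opposite orientations at the two ends of a line.
  refine (patternEval_basisQ _ _ _ _ (P.graph.valid ()) (fun i j h => o.out_line () i j h)
    (fun i => w ⟨(0 : Fin 1), i⟩)).trans ?_
  rw [Nat.cast_ite, Nat.cast_one, Nat.cast_zero]
  rfl
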